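/- Spheres in $\mathbb{R}^3$ include planes (curvature $0$). The curvature of a round sphere is the inverse of its radius, taken with a minus sign for a sphere enclosing the others. Spheres are tangent if the regions they bound (the ball, the exterior of the ball if the curvature is negative, one side of a plane) are disjoint and they have exactly one common point in $\mathbb{R}^3\cup\{\infty\}$. An octuple consists of four mutually tangent spheres $S_1,\dots,S_4$ and four mutually tangent spheres $S_1',\dots,S_4'$ inscribed in one of the two gaps that the $S_i$ form, where $S_i'$ is tangent to $S_j$ exactly when $j\neq i$. Its vector is $(b_1,b_2,b_3,b_4,\omega)$, where $b_i$ is the curvature of $S_i$ and $\omega$ is the average of the curvatures of $S_i$ and $S_i'$ (it does not depend on $i$). A generalized Apollonian sphere packing $\mathcal{P}$ is obtained from an octuple by repeatedly choosing four mutually tangent spheres of an octuple already constructed and inscribing four spheres in either of their two gaps as above. It is primitive integral if the eight curvatures of its initial octuple are coprime integers. A root octuple of $\mathcal{P}$ is a vector $(a,b,c,d,\omega)$ of an octuple of $\mathcal{P}$ with $a\le 0\le b\le c\le d\le\omega\le a+b+c+d$. **Theorem.** Let $\mathcal{P}$ be a primitive integral generalized Apollonian sphere packing, and let $(a_0,b_0,c_0,d_0,\omega_0)$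 be obtained from a root octuple of $\mathcal{P}$ by relabeling the first four entries so that $a_0$ is even and $b_0$ is odd, and then replacing $a_0$ by $2\omega_0-a_0$ if $a_0=0$. Put $$A_0=a_0+b_0,\quad B_0=-\frac{a_0+b_0+c_0+d_0-2\omega_0}{2},\quad C_0=-\frac{a_0+b_0+c_0-d_0}{2},\quad D_0=a_0+c_0 .$$ Then $A_0,B_0,C_0,D_0$ are integers, the quaternary quadratic form $$f_{a_0}(x,y,z,t)=A_0x^2+A_0y^2+4D_0z^2+4D_0t^2+4B_0xt-4B_0yz+4C_0xz+4C_0yt$$ is positive definite, and the set of curvatures of spheres in $\mathcal{P}$ contains every odd integer of the form $$f_{a_0}(\alpha_1,\alpha_2,\beta_1,\beta_2)-a_0,\qquad \alpha_1,\alpha_2,\beta_1,\beta_2\in\mathbb{Z},\quad \gcd\nolimits_{\mathbb{Z}[i]}(\alpha_1+i\alpha_2,\ \beta_1+i\beta_2)=1 .$$ -/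

import Mathlib

open scoped InnerProductSpace

/-- Spheres of `ℝ³` in the generalized sense, with a side: a round sphere with center `c` and
signed curvature `b ≠ 0` (so its radius is `|b|⁻¹`; the curvature is negative for a sphere that
encloses the others), or a plane `⟪p, x⟫ = h` with unit normal `p`. -/
inductive GenSphere : Type
  | round (c : EuclideanSpace ℝ (Fin 3)) (b : ℝ) (hb : b ≠ 0) : GenSphere
  | plane (p : EuclideanSpace ℝ (Fin 3)) (h : ℝ) (hp : ‖p‖ = 1) : GenSphere

namespace GenSphere

/-- The (signed) curvature; planes have curvature `0`. -/
def curvature : GenSphere → ℝ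
  | round _ b _ => b
  | plane _ _ _ => 0

/-- The open region bounded by a sphere: the open ball if the curvature is positive, the exterior
of the closed ball if it is negative, the open half-space `h < ⟪p, x⟫` for a plane. -/
def interior : GenSphere → Set (EuclideanSpace ℝ (Fin 3))
  | round c b _ => {x | (0 < b ∧ dist x c < |b|⁻¹) ∨ (b < 0 ∧ |b|⁻¹ < dist x c)}
  | plane p h _ => {x | h < ⟪p, x⟫_ℝ}

/-- The sphere as a set of points of `ℝ³ ∪ {∞}`; planes pass through `∞`. -/
def points : GenSphere → Set (OnePoint (EuclideanSpace ℝ (Fin 3)))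
  | round c b _ => (fun x : EuclideanSpace ℝ (Fin 3) => (x : OnePoint _)) '' {x | dist x c = |b|⁻¹}
  | plane p h _ => insert OnePoint.infty
      ((fun x : EuclideanSpace ℝ (Fin 3) => (x : OnePoint _)) '' {x | ⟪p, x⟫_ℝ = h})

/-- Two spheres are tangent: they have disjoint interiors and exactly one common point
(which is `∞` for two parallel planes). -/
def Tangent (S T : GenSphere) : Prop :=
  Disjoint S.interior T.interior ∧ ∃! x, x ∈ S.points ∧ x ∈ T.points

end GenSphere

/-- An octuple: four mutually tangent spheres `S i` and four mutually tangent spheres `S' i`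
inscribed in one of the two gaps formed by the `S i`, where `S' i` is tangent to `S j` exactly
when `j ≠ i`. -/
structure Octuple : Type where
  S : Fin 4 → GenSphere
  S' : Fin 4 → GenSphere
  tangent : ∀ i j, i ≠ j → (S i).Tangent (S j)
  tangent' : ∀ i j, i ≠ j → (S' i).Tangent (S' j)
  tangent_cross : ∀ i j, i ≠ j → (S i).Tangent (S' j)
  disjoint_pair : ∀ i, Disjoint (S i).interior (S' i).interior
  not_tangent_pair : ∀ i, ¬ (S i).Tangent (S' i)

namespace Octuple

/-- The set of the eight spheres of an octuple. -/
def spheres (O : Octuple) : Set GenSphere := Set.range O.S ∪ Set.range O.S'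

/-- The octuples of the generalized Apollonian sphere packing generated by `O₀`: starting from
`O₀`, one repeatedly picks four mutually tangent spheres of an octuple already constructed and
inscribes four new spheres in either of the two gaps that they form. -/
inductive InPacking (O₀ : Octuple) : Octuple → Prop
  | base : InPacking O₀ O₀
  | step (O O' : Octuple) : InPacking O₀ O → (∀ i, O'.S i ∈ O.spheres) → InPacking O₀ O'

/-- The spheres of the packing generated by `O₀`. -/
def packing (O₀ : Octuple) : Set GenSphere := {s | ∃ O, InPacking O₀ O ∧ s ∈ O.spheres}

/-- The set of curvatures of the spheres of the packing generated by `O₀`. -/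
def packingCurvatures (O₀ : Octuple) : Set ℝ := GenSphere.curvature '' packing O₀

/-- The packing generated by `O₀` is primitive integral: the eight curvatures of `O₀` are coprime
integers. -/
def IsPrimitiveIntegral (O₀ : Octuple) : Prop :=
  ∃ k k' : Fin 4 → ℤ,
    (∀ i, (O₀.S i).curvature = k i ∧ (O₀.S' i).curvature = k' i) ∧
    ∀ n : ℤ, (∀ i, n ∣ k i ∧ n ∣ k' i) → IsUnit n

/-- `(v 0, v 1, v 2, v 3, ω)` is the vector of curvatures of the octuple `O`: the curvatures of
`O.S 0, …, O.S 3`, and the average `ω` of the curvatures in each pair. -/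
def HasVector (O : Octuple) (v : Fin 4 → ℤ) (ω : ℤ) : Prop :=
  ∀ i, (O.S i).curvature = v i ∧ ((O.S i).curvature + (O.S' i).curvature) / 2 = ω

/-- `(v 0, v 1, v 2, v 3, ω)` is the root octuple of the packing generated by `O₀`. -/
def IsRootVector (O₀ : Octuple) (v : Fin 4 → ℤ) (ω : ℤ) : Prop :=
  (∃ O, InPacking O₀ O ∧ O.HasVector v ω) ∧
  v 0 ≤ 0 ∧ 0 ≤ v 1 ∧ v 1 ≤ v 2 ∧ v 2 ≤ v 3 ∧ v 3 ≤ ω ∧ ω ≤ v 0 + v 1 + v 2 + v 3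

/-- `(a, b, c, d, ω)` arises from the root octuple of the packing generated by `O₀` by relabeling
the first four entries so that the first one is even and the second one is odd, and then
replacing the first entry `a` by `2 ω - a` if it is zero. -/
def IsModifiedRootVector (O₀ : Octuple) (a b c d ω : ℤ) : Prop :=
  ∃ (v : Fin 4 → ℤ) (σ : Equiv.Perm (Fin 4)), IsRootVector O₀ v ω ∧
    Even (v (σ 0)) ∧ Odd (v (σ 1)) ∧
    a = (if v (σ 0) = 0 then 2 * ω - v (σ 0) else v (σ 0)) ∧
    b = v (σ 1) ∧ c = v (σ 2) ∧ d = v (σ 3)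

end Octuple

namespace ApollonianForm

/-- The coefficient `A₀`. -/
def coeffA (a b _c _d _ω : ℝ) : ℝ := a + b

/-- The coefficient `B₀`. -/
noncomputable def coeffB (a b c d ω : ℝ) : ℝ := -(a + b + c + d - 2 * ω) / 2

/-- The coefficient `C₀`. -/
noncomputable def coeffC (a b c d _ω : ℝ) : ℝ := -(a + b + c - d) / 2

/-- The coefficient `D₀`. -/
def coeffD (a _b c _d _ω : ℝ) : ℝ := a + c

/-- The product of two coordinates, as a quadratic form on `ℝ⁴`. -/
noncomputable def mon (i j : Fin 4) : QuadraticForm ℝ (Fin 4 → ℝ) :=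
  QuadraticMap.linMulLin (LinearMap.proj i) (LinearMap.proj j)

/-- The quaternary quadratic form `f_{a₀}` attached to `(a₀, b₀, c₀, d₀, ω₀)`. -/
noncomputable def form (a b c d ω : ℝ) : QuadraticForm ℝ (Fin 4 → ℝ) :=
  coeffA a b c d ω • (mon 0 0 + mon 1 1) + (4 * coeffD a b c d ω) • (mon 2 2 + mon 3 3)
    + (4 * coeffB a b c d ω) • (mon 0 3 - mon 1 2)
    + (4 * coeffC a b c d ω) • (mon 0 2 + mon 1 3)

theorem form_apply (a b c d ω x y z t : ℝ) :
    form a b c d ω ![x, y, z, t] =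
      coeffA a b c d ω * x ^ 2 + coeffA a b c d ω * y ^ 2
        + 4 * coeffD a b c d ω * z ^ 2 + 4 * coeffD a b c d ω * t ^ 2
        + 4 * x * t * coeffB a b c d ω - 4 * y * z * coeffB a b c d ω
        + 4 * x * z * coeffC a b c d ω + 4 * y * t * coeffC a b c d ω := by
  simp [form, mon, QuadraticMap.linMulLin_apply]
  ring

end ApollonianForm

/-! A sphere becomes a unit vector for a Lorentzian form `q` on ℝ⁵, with the curvature as first
coordinate. Tangency means that `q` is -1 and that the sum of the two vectors lies in the future
cone (`tangent_iff`). An octuple is then linear algebra: `q` is -3 on each pair (`q_pair`), so the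
four pairs share one midpoint `m`, and `m` with the four vectors is a basis with a fixed Gram matrix
(`exists_frame`). This gives a quadratic relation between the curvatures and, by reflecting `m`, the
octuple in the other gap.

Keep the first sphere and move the rest: permute the other pairs, exchange the spheres of a pair,
pass to the other gap. Each move acts on `hermForm` by a substitution in `(α, γ)`. Since
`Represents` speaks of all octuples of the packing, it is stable under these substitutions, hence
under swapping and under `α ↦ α + δ γ` for Gaussian `δ`. The Euclidean algorithm in ℤ[i] then
reduces every coprime pair to `γ = 0`, where the value is the curvature `v 1`.

The form of the theorem is `hermForm` at `(α, 2β)`. As `a₀` is even, an odd value forces `|α|²` to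
be odd, so `α` is coprime to `2β`. Definiteness follows by completing the square with `A D - B² - C²
= a²`. -/

/-! ### The Lorentzian form, the future cone and the null vectors of points. -/

namespace Lorentz

/-- The Lorentzian bilinear form on `ℝ⁵` in which generalized spheres are unit vectors. -/
noncomputable def q (x y : Fin 5 → ℝ) : ℝ :=
  x 1 * y 1 + x 2 * y 2 + x 3 * y 3 - (x 0 * y 4 + x 4 * y 0) / 2

theorem q_comm (x y : Fin 5 → ℝ) : q x y = q y x := by simp only [q]; ring

theorem q_add_left (x y z : Fin 5 → ℝ) : q (x + y) z = q x z + q y z := by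
  simp only [q, Pi.add_apply]; ring

theorem q_add_right (x y z : Fin 5 → ℝ) : q x (y + z) = q x y + q x z := by
  simp only [q, Pi.add_apply]; ring

theorem q_sub_left (x y z : Fin 5 → ℝ) : q (x - y) z = q x z - q y z := by
  simp only [q, Pi.sub_apply]; ring

theorem q_sub_right (x y z : Fin 5 → ℝ) : q x (y - z) = q x y - q x z := by
  simp only [q, Pi.sub_apply]; ring

theorem q_smul_left (r : ℝ) (x y : Fin 5 → ℝ) : q (r • x) y = r * q x y := by
  simp only [q, Pi.smul_apply, smul_eq_mul]; ring

theorem q_smul_right (r : ℝ) (x y : Fin 5 → ℝ) : q x (r • y) = r * q x y := by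
  simp only [q, Pi.smul_apply, smul_eq_mul]; ring

theorem q_zero_left (x : Fin 5 → ℝ) : q 0 x = 0 := by simp [q]

/-- The future cone: nonzero causal vectors of positive time component. -/
def Future (n : Fin 5 → ℝ) : Prop := q n n ≤ 0 ∧ 0 < n 0 + n 4

theorem Future.nonneg {n : Fin 5 → ℝ} (h : Future n) : 0 ≤ n 0 ∧ 0 ≤ n 4 := by
  obtain ⟨h1, h2⟩ := h
  have h3 : 0 ≤ n 0 * n 4 := by
    simp only [q] at h1
    nlinarith [sq_nonneg (n 1), sq_nonneg (n 2), sq_nonneg (n 3)]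
  constructor <;> by_contra! h4 <;> nlinarith

/-- Cauchy–Schwarz on the spatial part, then the inequality between arithmetic and geometric means
of `n 0 * k 4` and `n 4 * k 0`. -/
theorem Future.q_nonpos {n k : Fin 5 → ℝ} (hn : Future n) (hk : Future k) : q n k ≤ 0 := by
  obtain ⟨a1, a2⟩ := hn.nonneg
  obtain ⟨b1, b2⟩ := hk.nonneg
  have h1 := hn.1
  have h2 := hk.1
  simp only [q] at h1 h2 ⊢
  have hcs : (n 1 * k 1 + n 2 * k 2 + n 3 * k 3) ^ 2 ≤
      (n 1 ^ 2 + n 2 ^ 2 + n 3 ^ 2) * (k 1 ^ 2 + k 2 ^ 2 + k 3 ^ 2) := by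
    nlinarith [sq_nonneg (n 1 * k 2 - n 2 * k 1), sq_nonneg (n 1 * k 3 - n 3 * k 1),
      sq_nonneg (n 2 * k 3 - n 3 * k 2)]
  have hm : (n 1 ^ 2 + n 2 ^ 2 + n 3 ^ 2) * (k 1 ^ 2 + k 2 ^ 2 + k 3 ^ 2) ≤
      (n 0 * n 4) * (k 0 * k 4) := by
    apply mul_le_mul <;> first | positivity | nlinarith
  have : n 1 * k 1 + n 2 * k 2 + n 3 * k 3 ≤ (n 0 * k 4 + n 4 * k 0) / 2 := by
    apply le_of_sq_le_sq _ (by positivity)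
    nlinarith [sq_nonneg (n 0 * k 4 - n 4 * k 0)]
  linarith

theorem Future.of_q_neg {n k : Fin 5 → ℝ} (hn : Future n) (hk : q k k ≤ 0) (h : q n k < 0) :
    Future k := by
  refine ⟨hk, ?_⟩
  by_contra! hT
  rcases hT.lt_or_eq with hT | hT
  · have : Future ((-1 : ℝ) • k) := by
      refine ⟨by rw [q_smul_left, q_smul_right]; linarith, ?_⟩
      simp only [Pi.smul_apply, smul_eq_mul]; linarith
    have := hn.q_nonpos this
    rw [q_smul_right] at this
    linarith
  · have h4 : k 4 = - k 0 := by linarith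
    simp only [q, h4] at hk h
    have e0 : k 0 = 0 := by nlinarith [sq_nonneg (k 0), sq_nonneg (k 1), sq_nonneg (k 2), sq_nonneg (k 3)]
    have e1 : k 1 = 0 := by nlinarith [sq_nonneg (k 0), sq_nonneg (k 1), sq_nonneg (k 2), sq_nonneg (k 3)]
    have e2 : k 2 = 0 := by nlinarith [sq_nonneg (k 0), sq_nonneg (k 1), sq_nonneg (k 2), sq_nonneg (k 3)]
    have e3 : k 3 = 0 := by nlinarith [sq_nonneg (k 0), sq_nonneg (k 1), sq_nonneg (k 2), sq_nonneg (k 3)]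
    simp [e0, e1, e2, e3] at h

/-- The null vector of a point of `ℝ³`. -/
noncomputable def pt (x : EuclideanSpace ℝ (Fin 3)) : Fin 5 → ℝ :=
  ![1, x 0, x 1, x 2, x 0 ^ 2 + x 1 ^ 2 + x 2 ^ 2]

theorem q_pt (v : Fin 5 → ℝ) (x : EuclideanSpace ℝ (Fin 3)) :
    q v (pt x) = v 1 * x 0 + v 2 * x 1 + v 3 * x 2
      - (v 0 * (x 0 ^ 2 + x 1 ^ 2 + x 2 ^ 2) + v 4) / 2 := by
  simp [q, pt]

theorem future_pt (x : EuclideanSpace ℝ (Fin 3)) : Future (pt x) := by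
  constructor
  · rw [q_pt]; simp [pt]; linarith
  · simp [pt]; positivity

/-- A null vector is proportional to a point of ℝ³ or to ∞, and its product with `pt x` is then a
constant times a squared distance, or a constant. -/
theorem null_sign {d : Fin 5 → ℝ} (hd : q d d = 0) :
    (∀ x, q d (pt x) ≤ 0) ∨ ∀ x, 0 ≤ q d (pt x) := by
  have key : ∀ x, d 0 * (-2 * q d (pt x)) =
      (d 0 * x 0 - d 1) ^ 2 + (d 0 * x 1 - d 2) ^ 2 + (d 0 * x 2 - d 3) ^ 2 := by
    intro x
    rw [q_pt]; simp only [q] at hd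
    linear_combination - hd
  rcases lt_trichotomy (d 0) 0 with h | h | h
  · right; intro x
    have : 0 ≤ d 0 * (-2 * q d (pt x)) := by rw [key]; positivity
    nlinarith
  · simp only [q, h] at hd
    have e1 : d 1 = 0 := by nlinarith [sq_nonneg (d 1), sq_nonneg (d 2), sq_nonneg (d 3)]
    have e2 : d 2 = 0 := by nlinarith [sq_nonneg (d 1), sq_nonneg (d 2), sq_nonneg (d 3)]
    have e3 : d 3 = 0 := by nlinarith [sq_nonneg (d 1), sq_nonneg (d 2), sq_nonneg (d 3)]
    simp only [q_pt, h, e1, e2, e3]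
    rcases le_total 0 (d 4) with h4 | h4
    · left; intro x; linarith
    · right; intro x; linarith
  · left; intro x
    have : 0 ≤ d 0 * (-2 * q d (pt x)) := by rw [key]; positivity
    nlinarith

/-- Interiors are nonempty: the witnesses are a point at two radii from the centre of an exterior, a
point at unit height over a plane, and the centre of a ball. -/
theorem exists_q_pt_pos {v : Fin 5 → ℝ} (hv : q v v = 1) : ∃ x, 0 < q v (pt x) := by
  simp only [q] at hv
  rcases lt_trichotomy (v 0) 0 with h | h | h
  · refine ⟨!₂[(v 1 + 2) / v 0, v 2 / v 0, v 3 / v 0], ?_⟩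
    have : q v (pt !₂[(v 1 + 2) / v 0, v 2 / v 0, v 3 / v 0]) = -3 / (2 * v 0) := by
      have h4 : v 4 = (v 1 * v 1 + v 2 * v 2 + v 3 * v 3 - 1) / v 0 := by
        have := h.ne; field_simp; linarith
      rw [q_pt, h4]; simp; field_simp; ring
    rw [this]; exact div_pos_of_neg_of_neg (by norm_num) (by linarith)
  · refine ⟨!₂[(1 + v 4 / 2) * v 1, (1 + v 4 / 2) * v 2, (1 + v 4 / 2) * v 3], ?_⟩
    rw [q_pt]; simp only [h] at hv ⊢; simp
    linear_combination (-1 - v 4 / 2) * hv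
  · refine ⟨!₂[v 1 / v 0, v 2 / v 0, v 3 / v 0], ?_⟩
    have : q v (pt !₂[v 1 / v 0, v 2 / v 0, v 3 / v 0]) = 1 / (2 * v 0) := by
      rw [q_pt]; simp; field_simp; linear_combination hv
    rw [this]; positivity

end Lorentz

/-! ### Spheres as unit vectors. -/

namespace GenSphere

open Lorentz

/-- The unit vector of the Lorentzian space that represents a generalized sphere. -/
noncomputable def vec : GenSphere → Fin 5 → ℝ
  | round c b _ => ![b, b * c 0, b * c 1, b * c 2, b * (c 0 ^ 2 + c 1 ^ 2 + c 2 ^ 2) - b⁻¹]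
  | plane p h _ => ![0, p 0, p 1, p 2, 2 * h]

theorem vec_zero (S : GenSphere) : S.vec 0 = S.curvature := by
  cases S <;> simp [vec, curvature]

theorem q_vec (S : GenSphere) : q S.vec S.vec = 1 := by
  cases S with
  | round c b hb => simp [vec, q]; field_simp; ring
  | plane p h hp =>
    rw [EuclideanSpace.norm_eq, Real.sqrt_eq_one] at hp
    simp [Fin.sum_univ_three] at hp
    simp [vec, q]; linarith

theorem exists_vec_eq {v : Fin 5 → ℝ} (hv : q v v = 1) : ∃ S : GenSphere, S.vec = v := by
  simp only [q] at hv
  by_cases h : v 0 = 0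
  · refine ⟨plane !₂[v 1, v 2, v 3] (v 4 / 2) ?_, ?_⟩
    · rw [EuclideanSpace.norm_eq, Real.sqrt_eq_one]
      simp [Fin.sum_univ_three]; rw [h] at hv; linarith
    · ext i; fin_cases i <;> simp [vec, h]; ring
  · refine ⟨round !₂[v 1 / v 0, v 2 / v 0, v 3 / v 0] (v 0) h, ?_⟩
    ext i; fin_cases i <;> simp [vec] <;> field_simp
    linear_combination hv

theorem dist_sq (x c : EuclideanSpace ℝ (Fin 3)) :
    dist x c ^ 2 = (x 0 - c 0) ^ 2 + (x 1 - c 1) ^ 2 + (x 2 - c 2) ^ 2 := by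
  rw [EuclideanSpace.dist_eq, Real.sq_sqrt (Finset.sum_nonneg fun _ _ => sq_nonneg _)]
  simp [Fin.sum_univ_three, Real.dist_eq, sq_abs]

theorem q_vec_round (c x : EuclideanSpace ℝ (Fin 3)) (b : ℝ) (hb : b ≠ 0) :
    q (round c b hb).vec (pt x) = b / 2 * (|b|⁻¹ ^ 2 - dist x c ^ 2) := by
  rw [dist_sq, q_pt, inv_pow, sq_abs]
  simp [vec]; field_simp; ring

theorem q_vec_plane (p x : EuclideanSpace ℝ (Fin 3)) (h : ℝ) (hp : ‖p‖ = 1) :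
    q (plane p h hp).vec (pt x) = ⟪p, x⟫_ℝ - h := by
  rw [q_pt]; simp [vec, PiLp.inner_apply, Fin.sum_univ_three]; ring

theorem mem_interior_iff (S : GenSphere) (x : EuclideanSpace ℝ (Fin 3)) :
    x ∈ S.interior ↔ 0 < q S.vec (pt x) := by
  cases S with
  | round c b hb =>
    rw [q_vec_round]
    have h0 : 0 ≤ |b|⁻¹ := by positivity
    simp only [interior, Set.mem_ofPred_eq]
    rcases lt_or_gt_of_ne hb with h | h
    · rw [← sq_lt_sq₀ h0 dist_nonneg]
      simp only [h, not_lt_of_gt h, false_and, true_and, false_or]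
      constructor <;> intro h' <;> nlinarith
    · rw [← sq_lt_sq₀ dist_nonneg h0]
      simp only [h, not_lt_of_gt h, false_and, true_and, or_false]
      constructor <;> intro h' <;> nlinarith
  | plane p h hp => rw [q_vec_plane, sub_pos]; rfl

theorem coe_mem_points_iff (S : GenSphere) (x : EuclideanSpace ℝ (Fin 3)) :
    (x : OnePoint (EuclideanSpace ℝ (Fin 3))) ∈ S.points ↔ q S.vec (pt x) = 0 := by
  cases S with
  | round c b hb =>
    rw [q_vec_round]
    have h0 : 0 ≤ |b|⁻¹ := by positivity
    simp only [points, Set.mem_image, Set.mem_ofPred_eq, OnePoint.coe_eq_coe, exists_eq_right]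
    rw [← sq_eq_sq₀ dist_nonneg h0]
    rw [mul_eq_zero, or_iff_right (by simpa using hb), sub_eq_zero, eq_comm]
  | plane p h hp =>
    rw [q_vec_plane, sub_eq_zero]
    simp [points]

theorem infty_mem_points_iff (S : GenSphere) : OnePoint.infty ∈ S.points ↔ S.vec 0 = 0 := by
  cases S with
  | round c b hb => simp [points, vec, hb]
  | plane p h hp => simp [points, vec]

theorem tangent_symm {S T : GenSphere} (h : S.Tangent T) : T.Tangent S :=
  ⟨h.1.symm, by simpa only [and_comm] using h.2⟩

theorem disjoint_of_future {S T : GenSphere} (h : Future (S.vec + T.vec)) :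
    Disjoint S.interior T.interior := by
  rw [Set.disjoint_left]
  intro x hS hT
  rw [mem_interior_iff] at hS hT
  have := h.q_nonpos (future_pt x)
  rw [q_add_left] at this
  linarith

/-- The sum `n` of the two vectors is null and orthogonal to both, so it is a multiple of the null
vector of the point of tangency, which is ∞ exactly when `n 0 = 0`. -/
theorem tangent_of_q {S T : GenSphere} (h : q S.vec T.vec = -1) (hF : Future (S.vec + T.vec)) :
    S.Tangent T := by
  refine ⟨disjoint_of_future hF, ?_⟩
  obtain ⟨n, hn⟩ : ∃ n, n = S.vec + T.vec := ⟨_, rfl⟩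
  have hT : T.vec = n - S.vec := by rw [hn]; abel
  have hSn : q S.vec n = 0 := by rw [hn, q_add_right, q_vec, h]; norm_num
  have hnn : q n n = 0 := by
    nth_rw 1 [hn]; rw [q_add_left, hSn, hn, q_add_right, q_comm, h, q_vec]; norm_num
  rw [← hn] at hF
  have n0 := hF.nonneg.1
  have nT := hF.2
  simp only [q] at hSn hnn
  rcases n0.lt_or_eq with n0 | n0
  · have hq : ∀ v, q v (pt !₂[n 1 / n 0, n 2 / n 0, n 3 / n 0]) = q v n / n 0 := by
      intro v
      rw [q_pt]; simp [q]; field_simp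
      linear_combination -(v 0) * hnn
    refine ⟨((!₂[n 1 / n 0, n 2 / n 0, n 3 / n 0] : EuclideanSpace ℝ (Fin 3)) : OnePoint _),
      ⟨?_, ?_⟩, ?_⟩
    · rw [coe_mem_points_iff, hq]; simp only [q]; rw [hSn, zero_div]
    · rw [coe_mem_points_iff, hT, q_sub_left, hq, hq]; simp only [q]; rw [hSn, hnn]; simp
    · rintro y ⟨y1, y2⟩
      induction y using OnePoint.rec with
      | infty =>
        rw [infty_mem_points_iff] at y1 y2
        rw [hn, Pi.add_apply, y1, y2] at n0
        simp at n0
      | coe y =>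
        rw [coe_mem_points_iff] at y1 y2
        have h0 : q n (pt y) = 0 := by rw [hn, q_add_left, y1, y2, add_zero]
        rw [q_pt] at h0
        have hs : (n 0 * y 0 - n 1) ^ 2 + (n 0 * y 1 - n 2) ^ 2 + (n 0 * y 2 - n 3) ^ 2 = 0 := by
          linear_combination hnn - 2 * n 0 * h0
        have e1 : n 0 * y 0 - n 1 = 0 := by
          nlinarith [sq_nonneg (n 0 * y 0 - n 1), sq_nonneg (n 0 * y 1 - n 2),
            sq_nonneg (n 0 * y 2 - n 3)]
        have e2 : n 0 * y 1 - n 2 = 0 := by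
          nlinarith [sq_nonneg (n 0 * y 0 - n 1), sq_nonneg (n 0 * y 1 - n 2),
            sq_nonneg (n 0 * y 2 - n 3)]
        have e3 : n 0 * y 2 - n 3 = 0 := by
          nlinarith [sq_nonneg (n 0 * y 0 - n 1), sq_nonneg (n 0 * y 1 - n 2),
            sq_nonneg (n 0 * y 2 - n 3)]
        congr 1
        ext i; fin_cases i <;> simp <;> field_simp <;> linarith
  · rw [← n0] at hnn hSn
    have e1 : n 1 = 0 := by nlinarith [sq_nonneg (n 1), sq_nonneg (n 2), sq_nonneg (n 3)]
    have e2 : n 2 = 0 := by nlinarith [sq_nonneg (n 1), sq_nonneg (n 2), sq_nonneg (n 3)]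
    have e3 : n 3 = 0 := by nlinarith [sq_nonneg (n 1), sq_nonneg (n 2), sq_nonneg (n 3)]
    have e4 : 0 < n 4 := by linarith
    have hS0 : S.vec 0 = 0 := by
      rw [e1, e2, e3] at hSn
      have : S.vec 0 * n 4 = 0 := by linarith
      rcases mul_eq_zero.1 this with h | h
      · exact h
      · exact absurd h e4.ne'
    refine ⟨OnePoint.infty, ⟨?_, ?_⟩, ?_⟩
    · rwa [infty_mem_points_iff]
    · rw [infty_mem_points_iff, hT, Pi.sub_apply, hS0, ← n0, sub_zero]
    · rintro y ⟨y1, y2⟩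
      induction y using OnePoint.rec with
      | infty => rfl
      | coe y =>
        rw [coe_mem_points_iff] at y1 y2
        have h0 : q n (pt y) = 0 := by rw [hn, q_add_left, y1, y2, add_zero]
        rw [q_pt, e1, e2, e3, ← n0] at h0
        linarith

end GenSphere

/-! ### Tangency forces the Lorentz product -1. -/

namespace Lorentz

theorem exists_ne_zero_dot_eq {N₁ N₂ N₃ : ℝ} (hN : N₁ ^ 2 + N₂ ^ 2 + N₃ ^ 2 = 1) (k : ℝ) :
    ∃ y₁ y₂ y₃ : ℝ, 0 < y₁ ^ 2 + y₂ ^ 2 + y₃ ^ 2 ∧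
      y₁ * N₁ + y₂ * N₂ + y₃ * N₃ = k * (y₁ ^ 2 + y₂ ^ 2 + y₃ ^ 2) := by
  by_cases hk : k = 0
  · by_cases h1 : N₁ ^ 2 + N₂ ^ 2 = 0
    · refine ⟨1, 0, 0, by norm_num, ?_⟩
      have : N₁ = 0 := by nlinarith [sq_nonneg N₁, sq_nonneg N₂]
      simp [this, hk]
    · exact ⟨N₂, -N₁, 0, by have := lt_of_le_of_ne (by positivity) (Ne.symm h1); linarith,
        by rw [hk]; ring⟩
  · have e : (N₁ / k) ^ 2 + (N₂ / k) ^ 2 + (N₃ / k) ^ 2 = 1 / k ^ 2 := by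
      rw [← hN]; ring
    refine ⟨N₁ / k, N₂ / k, N₃ / k, by rw [e]; positivity, ?_⟩
    rw [e]; field_simp; linarith

/-- Two quadrics through the origin with unit normals `N`, `M` and curvatures `b`, `c`, whose
interiors are disjoint and which meet only in the origin. -/
theorem opposite_of_disjoint {N₁ N₂ N₃ M₁ M₂ M₃ b c : ℝ} (hN : N₁ ^ 2 + N₂ ^ 2 + N₃ ^ 2 = 1)
    (hM : M₁ ^ 2 + M₂ ^ 2 + M₃ ^ 2 = 1)
    (hd : ∀ y₁ y₂ y₃ : ℝ,
      0 < -(y₁ * N₁ + y₂ * N₂ + y₃ * N₃) - b * (y₁ ^ 2 + y₂ ^ 2 + y₃ ^ 2) / 2 →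
      0 < -(y₁ * M₁ + y₂ * M₂ + y₃ * M₃) - c * (y₁ ^ 2 + y₂ ^ 2 + y₃ ^ 2) / 2 → False)
    (hu : ∀ y₁ y₂ y₃ : ℝ,
      -(y₁ * N₁ + y₂ * N₂ + y₃ * N₃) - b * (y₁ ^ 2 + y₂ ^ 2 + y₃ ^ 2) / 2 = 0 →
      -(y₁ * M₁ + y₂ * M₂ + y₃ * M₃) - c * (y₁ ^ 2 + y₂ ^ 2 + y₃ ^ 2) / 2 = 0 →
      y₁ ^ 2 + y₂ ^ 2 + y₃ ^ 2 = 0) :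
    (M₁ = -N₁ ∧ M₂ = -N₂ ∧ M₃ = -N₃) ∧ 0 < b + c := by
  have h1 : (M₁ = -N₁ ∧ M₂ = -N₂ ∧ M₃ = -N₃) := by
    obtain ⟨k, hk⟩ : ∃ k, k = 1 + (N₁ * M₁ + N₂ * M₂ + N₃ * M₃) := ⟨_, rfl⟩
    have hk2 : (N₁ + M₁) ^ 2 + (N₂ + M₂) ^ 2 + (N₃ + M₃) ^ 2 = 2 * k := by
      rw [hk]; linear_combination hN + hM
    -- If the normals were not opposite, a short step along `-(N + M)` would enter both interiors;
    -- `s` is small enough to beat both curvatures.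
    have k0 : k ≤ 0 := by
      by_contra! k0
      obtain ⟨s, hs⟩ : ∃ s, s = 1 / (1 + |b| + |c|) := ⟨_, rfl⟩
      have s0 : 0 < s := by rw [hs]; positivity
      have hs1 : s * (1 + |b| + |c|) = 1 := by rw [hs]; field_simp
      have hb : 0 < 1 - s * b := by
        nlinarith [le_abs_self b, abs_nonneg c]
      have hc : 0 < 1 - s * c := by
        nlinarith [le_abs_self c, abs_nonneg b]
      refine hd (-s * (N₁ + M₁)) (-s * (N₂ + M₂)) (-s * (N₃ + M₃)) ?_ ?_
      · have : 0 < s * k * (1 - s * b) := by positivity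
        refine this.trans_eq ?_
        linear_combination (-s) * hN + s * hk + b / 2 * s ^ 2 * hk2
      · have : 0 < s * k * (1 - s * c) := by positivity
        refine this.trans_eq ?_
        linear_combination (-s) * hM + s * hk + c / 2 * s ^ 2 * hk2
    refine ⟨?_, ?_, ?_⟩ <;>
    nlinarith [sq_nonneg (N₁ + M₁), sq_nonneg (N₂ + M₂), sq_nonneg (N₃ + M₃)]
  refine ⟨h1, ?_⟩
  obtain ⟨rfl, rfl, rfl⟩ := h1
  -- With this constant both functions take the value `-(b + c) / 4 * |y|²` at `y`: a common
  -- interior point if `b + c < 0`, a second common point if `b + c = 0`.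
  obtain ⟨y₁, y₂, y₃, y0, hy⟩ := exists_ne_zero_dot_eq hN ((c - b) / 4)
  by_contra! hbc
  rcases hbc.lt_or_eq with hbc | hbc
  · have : 0 < -(b + c) / 4 * (y₁ ^ 2 + y₂ ^ 2 + y₃ ^ 2) := mul_pos (by linarith) y0
    refine hd y₁ y₂ y₃ (this.trans_eq ?_) (this.trans_eq ?_)
    · linear_combination hy
    · linear_combination -hy
  · refine y0.ne' (hu y₁ y₂ y₃ ?_ ?_)
    · linear_combination -hy - (y₁ ^ 2 + y₂ ^ 2 + y₃ ^ 2) / 4 * hbc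
    · linear_combination hy - (y₁ ^ 2 + y₂ ^ 2 + y₃ ^ 2) / 4 * hbc

end Lorentz

namespace GenSphere

open Lorentz

theorem q_future_of_tangent_at_coe {S T : GenSphere} (h : S.Tangent T)
    {x : EuclideanSpace ℝ (Fin 3)} (hS : (x : OnePoint (EuclideanSpace ℝ (Fin 3))) ∈ S.points)
    (hT : (x : OnePoint (EuclideanSpace ℝ (Fin 3))) ∈ T.points) :
    q S.vec T.vec = -1 ∧ 0 < S.vec 0 + T.vec 0 := by
  have uniq : ∀ y : EuclideanSpace ℝ (Fin 3), q S.vec (pt y) = 0 → q T.vec (pt y) = 0 →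
      y = x := fun y h1 h2 => OnePoint.coe_injective
    (h.2.unique ⟨(coe_mem_points_iff _ _).2 h1, (coe_mem_points_iff _ _).2 h2⟩ ⟨hS, hT⟩)
  have disj : ∀ y, 0 < q S.vec (pt y) → 0 < q T.vec (pt y) → False := fun y h1 h2 =>
    Set.disjoint_left.1 h.1 ((mem_interior_iff _ _).2 h1) ((mem_interior_iff _ _).2 h2)
  rw [coe_mem_points_iff] at hS hT
  have shift : ∀ v : Fin 5 → ℝ, q v (pt x) = 0 → ∀ y₁ y₂ y₃ : ℝ,
      q v (pt !₂[x 0 + y₁, x 1 + y₂, x 2 + y₃]) =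
        -(y₁ * (v 0 * x 0 - v 1) + y₂ * (v 0 * x 1 - v 2) + y₃ * (v 0 * x 2 - v 3))
          - v 0 * (y₁ ^ 2 + y₂ ^ 2 + y₃ ^ 2) / 2 := by
    intro v hv y₁ y₂ y₃
    rw [q_pt] at hv ⊢
    simp
    linear_combination hv
  have unit : ∀ v : Fin 5 → ℝ, q v v = 1 → q v (pt x) = 0 →
      (v 0 * x 0 - v 1) ^ 2 + (v 0 * x 1 - v 2) ^ 2 + (v 0 * x 2 - v 3) ^ 2 = 1 := by
    intro v h1 h2
    rw [q_pt] at h2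
    simp only [q] at h1
    linear_combination h1 - 2 * v 0 * h2
  obtain ⟨⟨e1, e2, e3⟩, hpos⟩ := opposite_of_disjoint (unit _ S.q_vec hS) (unit _ T.q_vec hT)
    (b := S.vec 0) (c := T.vec 0)
    (fun y₁ y₂ y₃ h1 h2 => disj _ ((shift _ hS y₁ y₂ y₃).symm ▸ h1)
      ((shift _ hT y₁ y₂ y₃).symm ▸ h2))
    (fun y₁ y₂ y₃ h1 h2 => by
      have := uniq _ ((shift _ hS y₁ y₂ y₃).trans h1) ((shift _ hT y₁ y₂ y₃).trans h2)
      have f0 := congrArg (fun z : EuclideanSpace ℝ (Fin 3) => z 0) this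
      have f1 := congrArg (fun z : EuclideanSpace ℝ (Fin 3) => z 1) this
      have f2 := congrArg (fun z : EuclideanSpace ℝ (Fin 3) => z 2) this
      simp at f0 f1 f2
      simp [f0, f1, f2])
  refine ⟨?_, hpos⟩
  have hu := unit _ S.q_vec hS
  rw [q_pt] at hS hT
  simp only [q]
  linear_combination (S.vec 0) * hT + T.vec 0 * hS - hu
    + (S.vec 0 * x 0 - S.vec 1) * e1 + (S.vec 0 * x 1 - S.vec 2) * e2
    + (S.vec 0 * x 2 - S.vec 3) * e3

theorem q_future_of_tangent_at_infty {S T : GenSphere} (h : S.Tangent T)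
    (hS : OnePoint.infty ∈ S.points) (hT : OnePoint.infty ∈ T.points) :
    q S.vec T.vec = -1 ∧ S.vec 0 + T.vec 0 = 0 ∧ 0 < S.vec 4 + T.vec 4 := by
  have uniq : ∀ y : EuclideanSpace ℝ (Fin 3), q S.vec (pt y) = 0 → q T.vec (pt y) = 0 →
      False := fun y h1 h2 => OnePoint.coe_ne_infty y
    (h.2.unique ⟨(coe_mem_points_iff _ _).2 h1, (coe_mem_points_iff _ _).2 h2⟩ ⟨hS, hT⟩)
  have disj : ∀ y, 0 < q S.vec (pt y) → 0 < q T.vec (pt y) → False := fun y h1 h2 =>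
    Set.disjoint_left.1 h.1 ((mem_interior_iff _ _).2 h1) ((mem_interior_iff _ _).2 h2)
  rw [infty_mem_points_iff] at hS hT
  have hv := S.q_vec
  have hw := T.q_vec
  generalize S.vec = v at *
  generalize T.vec = w at *
  simp only [q, hS, hT] at hv hw ⊢
  obtain ⟨k, hk⟩ : ∃ k, k = 1 + (v 1 * w 1 + v 2 * w 2 + v 3 * w 3) := ⟨_, rfl⟩
  have hk2 : (v 1 + w 1) ^ 2 + (v 2 + w 2) ^ 2 + (v 3 + w 3) ^ 2 = 2 * k := by
    rw [hk]; linear_combination hv + hw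
  have k0 : k ≤ 0 := by
    by_contra! k0
    -- For planes with non-opposite normals, a point far out along `v + w` lies in both half-spaces;
    -- this factor outweighs both offsets.
    have hs : (1 + |v 4| + |w 4|) / k * k = 1 + |v 4| + |w 4| := by field_simp
    refine disj !₂[(1 + |v 4| + |w 4|) / k * (v 1 + w 1), (1 + |v 4| + |w 4|) / k * (v 2 + w 2),
      (1 + |v 4| + |w 4|) / k * (v 3 + w 3)] ?_ ?_
    · have : 0 < 1 + |v 4| + |w 4| - v 4 / 2 := by
        linarith [le_abs_self (v 4), abs_nonneg (w 4), abs_nonneg (v 4)]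
      rw [q_pt, hS]; simp
      linear_combination this + (1 + |v 4| + |w 4|) / k * (hk - hv) - hs
    · have : 0 < 1 + |v 4| + |w 4| - w 4 / 2 := by
        linarith [le_abs_self (w 4), abs_nonneg (w 4), abs_nonneg (v 4)]
      rw [q_pt, hT]; simp
      linear_combination this + (1 + |v 4| + |w 4|) / k * (hk - hw) - hs
  have e1 : w 1 = - v 1 := by
    nlinarith [sq_nonneg (v 1 + w 1), sq_nonneg (v 2 + w 2), sq_nonneg (v 3 + w 3)]
  have e2 : w 2 = - v 2 := by
    nlinarith [sq_nonneg (v 1 + w 1), sq_nonneg (v 2 + w 2), sq_nonneg (v 3 + w 3)]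
  have e3 : w 3 = - v 3 := by
    nlinarith [sq_nonneg (v 1 + w 1), sq_nonneg (v 2 + w 2), sq_nonneg (v 3 + w 3)]
  have hq : ∀ s : ℝ, q v (pt !₂[s * v 1, s * v 2, s * v 3]) = s - v 4 / 2 ∧
      q w (pt !₂[s * v 1, s * v 2, s * v 3]) = -s - w 4 / 2 := by
    intro s
    rw [q_pt, q_pt, hS, hT, e1, e2, e3]
    constructor
    · simp; linear_combination s * hv
    · simp; linear_combination -s * hv
  refine ⟨by rw [e1, e2, e3]; linear_combination -hv, by norm_num, ?_⟩
  -- The value of `s` at which both products equal `-(v 4 + w 4) / 4`.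
  obtain ⟨g1, g2⟩ := hq ((v 4 - w 4) / 4)
  by_contra! hT4
  rcases hT4.lt_or_eq with h4 | h4
  · exact disj _ (by rw [g1]; linarith) (by rw [g2]; linarith)
  · exact uniq _ (by rw [g1]; linarith) (by rw [g2]; linarith)

theorem tangent_iff {S T : GenSphere} :
    S.Tangent T ↔ q S.vec T.vec = -1 ∧ Future (S.vec + T.vec) := by
  refine ⟨fun h => ?_, fun h => tangent_of_q h.1 h.2⟩
  have null : q S.vec T.vec = -1 → q (S.vec + T.vec) (S.vec + T.vec) = 0 := by
    intro h
    rw [q_add_left, q_add_right, q_add_right, q_comm T.vec S.vec, h, q_vec, q_vec]; norm_num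
  obtain ⟨x, ⟨hS, hT⟩, -⟩ := h.2
  induction x using OnePoint.rec with
  | infty =>
    obtain ⟨h1, h2, h3⟩ := q_future_of_tangent_at_infty h hS hT
    refine ⟨h1, (null h1).le, ?_⟩
    simp only [Pi.add_apply]; linarith
  | coe x =>
    obtain ⟨h1, h2⟩ := q_future_of_tangent_at_coe h hS hT
    refine ⟨h1, (null h1).le, ?_⟩
    have h3 := null h1
    rw [← Pi.add_apply] at h2
    generalize S.vec + T.vec = n at *
    simp only [q] at h3
    have : 0 ≤ n 4 := by
      by_contra! h4
      nlinarith [sq_nonneg (n 1), sq_nonneg (n 2), sq_nonneg (n 3)]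
    linarith

/-- By `null_sign` one of the two interiors contains the other, and neither is empty. -/
theorem not_disjoint_of_null {S T : GenSphere} (h : q (T.vec - S.vec) (T.vec - S.vec) = 0) :
    ¬ Disjoint S.interior T.interior := by
  rw [Set.not_disjoint_iff]
  rcases null_sign h with h | h
  · obtain ⟨x, hx⟩ := exists_q_pt_pos T.q_vec
    have := h x
    rw [q_sub_left] at this
    exact ⟨x, (mem_interior_iff _ _).2 (by linarith), (mem_interior_iff _ _).2 hx⟩
  · obtain ⟨x, hx⟩ := exists_q_pt_pos S.q_vec
    have := h x
    rw [q_sub_left] at this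
    exact ⟨x, (mem_interior_iff _ _).2 hx, (mem_interior_iff _ _).2 (by linarith)⟩

end GenSphere

/-! ### Gram matrices and frames. -/

namespace Lorentz

theorem exists_relation_six (v : Fin 6 → Fin 5 → ℝ) :
    ∃ c : Fin 6 → ℝ, c ≠ 0 ∧ ∀ x, ∑ i, c i * q (v i) x = 0 := by
  have h : Module.finrank ℝ (Fin 5 → ℝ) < Module.finrank ℝ (Fin 6 → ℝ) := by simp
  have := LinearMap.ker_ne_bot_of_finrank_lt (f := Fintype.linearCombination ℝ v) h
  obtain ⟨c, hc, c0⟩ := (Submodule.ne_bot_iff _).1 this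
  refine ⟨c, c0, fun x => ?_⟩
  rw [LinearMap.mem_ker, Fintype.linearCombination_apply] at hc
  have h2 : q (∑ i, c i • v i) x = 0 := by rw [hc, q_zero_left]
  simpa [Fin.sum_univ_succ, q_add_left, q_smul_left] using h2

/-- Four mutually tangent unit vectors, with two further unit vectors `p` and `p'` tangent to each
other and to all of the four but `s₀`, respectively `s₁`. -/
theorem inscribed_relation {s₀ s₁ s₂ s₃ p p' : Fin 5 → ℝ}
    (h00 : q s₀ s₀ = 1) (h11 : q s₁ s₁ = 1) (h22 : q s₂ s₂ = 1) (h33 : q s₃ s₃ = 1)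
    (h01 : q s₀ s₁ = -1) (h02 : q s₀ s₂ = -1) (h03 : q s₀ s₃ = -1)
    (h12 : q s₁ s₂ = -1) (h13 : q s₁ s₃ = -1) (h23 : q s₂ s₃ = -1)
    (hp1 : q p s₁ = -1) (hp2 : q p s₂ = -1) (hp3 : q p s₃ = -1)
    (hp0' : q p' s₀ = -1) (hp2' : q p' s₂ = -1) (hp3' : q p' s₃ = -1)
    (hpp : q p p = 1) (hpp' : q p' p' = 1) (hp : q p p' = -1)
    (h0 : q p s₀ ≠ 1) (h1 : q p' s₁ ≠ 1) : q p s₀ + q p' s₁ = -6 := by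
  obtain ⟨c, c0, hc⟩ := exists_relation_six ![s₀, s₁, s₂, s₃, p, p']
  have e0 := hc s₀
  have e1 := hc s₁
  have e2 := hc s₂
  have e3 := hc s₃
  have ep := hc p
  have ep' := hc p'
  simp only [Fin.sum_univ_six, Matrix.cons_val] at e0 e1 e2 e3 ep ep'
  rw [q_comm s₁, q_comm s₂, q_comm s₃, h00, h01, h02, h03, hp0'] at e0
  rw [q_comm s₂, q_comm s₃, h11, h01, h12, h13, hp1] at e1
  rw [q_comm s₃, h22, h02, h12, h23, hp2, hp2'] at e2
  rw [h33, h03, h13, h23, hp3, hp3'] at e3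
  rw [q_comm s₀, q_comm s₁, q_comm s₂, q_comm s₃, q_comm p', hp1, hp2, hp3, hp, hpp] at ep
  rw [q_comm s₀, q_comm s₁, q_comm s₂, q_comm s₃, hp0', hp2', hp3', hp, hpp'] at ep'
  generalize q p s₀ = t at *
  generalize q p' s₁ = u at *
  have hX : c 0 + c 1 + c 2 + c 3 =
      -2 * (c 4 + c 5) + ((t + 1) * c 4 + (u + 1) * c 5) / 2 := by
    linear_combination (-1 / 2) * (e0 + e1 + e2 + e3)
  have f0 : c 4 * (4 - (t + 3) ^ 2 / 4) + c 5 * ((1 - t) * (1 - u) / 4) = 0 := by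
    linear_combination ep - (t + 1) / 2 * e0 + (1 - (t + 1) / 2) * hX
  have f1 : c 5 * (4 - (u + 3) ^ 2 / 4) + c 4 * ((1 - t) * (1 - u) / 4) = 0 := by
    linear_combination ep' - (u + 1) / 2 * e1 + (1 - (u + 1) / 2) * hX
  by_contra hne
  have ht : 1 - t ≠ 0 := sub_ne_zero.2 (Ne.symm h0)
  have hu : 1 - u ≠ 0 := sub_ne_zero.2 (Ne.symm h1)
  have g0 : c 4 * (7 + t) + c 5 * (1 - u) = 0 := by
    apply mul_left_cancel₀ ht; linear_combination 4 * f0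
  have g1 : c 5 * (7 + u) + c 4 * (1 - t) = 0 := by
    apply mul_left_cancel₀ hu; linear_combination 4 * f1
  -- The system `g0`, `g1` in `c 4`, `c 5` has determinant `8 * (t + u + 6)`; if it were nonzero,
  -- the linear relation would be trivial.
  have hs : t + u + 6 ≠ 0 := fun h => hne (by linarith)
  have z4 : c 4 = 0 := by
    apply mul_left_cancel₀ hs
    linear_combination (7 + u) / 8 * g0 - (1 - u) / 8 * g1
  have z5 : c 5 = 0 := by
    apply mul_left_cancel₀ hu
    linear_combination g0 - (7 + t) * z4
  simp only [z4, z5] at e0 e1 e2 e3 hX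
  apply c0
  ext i
  fin_cases i <;> simp [z4, z5] <;> linarith

/-- The vectors of four mutually tangent spheres, with the common midpoint of the four pairs. -/
structure IsFrame (s : Fin 4 → Fin 5 → ℝ) (m : Fin 5 → ℝ) : Prop where
  gram : ∀ i j, q (s i) (s j) = if i = j then 1 else -1
  mid : ∀ i, q m (s i) = -1
  mid_self : q m m = -1
  future : Future m

/-- The vectors `s i - m` and `m` are orthogonal, with squares 2 and -1, so they form a basis; this
is the expansion of `q` in it. -/
theorem q_eq_of_gram {s : Fin 4 → Fin 5 → ℝ} {m : Fin 5 → ℝ}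
    (gram : ∀ i j, q (s i) (s j) = if i = j then 1 else -1) (mid : ∀ i, q m (s i) = -1)
    (mid_self : q m m = -1) (x y : Fin 5 → ℝ) :
    q x y = (∑ i, q x (s i) * q y (s i)) / 2
      - (q x m * (∑ i, q y (s i)) + q y m * ∑ i, q x (s i)) / 2 + q x m * q y m := by
  obtain ⟨c, c0, hc⟩ := exists_relation_six ![s 0, s 1, s 2, s 3, m, x]
  have e := fun i => hc (s i)
  have em := hc m
  have ey := hc y
  simp only [Fin.sum_univ_six, Matrix.cons_val, gram, mid] at e
  simp only [Fin.sum_univ_six, Matrix.cons_val, q_comm (s _) m, mid, mid_self] at em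
  simp only [Fin.sum_univ_six, Matrix.cons_val, q_comm (s _) y, q_comm m y] at ey
  have e0 := e 0
  have e1 := e 1
  have e2 := e 2
  have e3 := e 3
  simp at e0 e1 e2 e3
  have h5 : c 5 ≠ 0 := by
    intro h5
    simp only [h5] at e0 e1 e2 e3 em
    apply c0
    ext i
    fin_cases i <;> simp <;> linarith
  simp only [Fin.sum_univ_four]
  apply mul_left_cancel₀ h5
  have hX : c 0 + c 1 + c 2 + c 3 + c 4 = c 5 * q x m := by linear_combination -em
  have k0 : c 0 = - c 5 * (q x (s 0) - q x m) / 2 := by linear_combination (e0 + hX) / 2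
  have k1 : c 1 = - c 5 * (q x (s 1) - q x m) / 2 := by linear_combination (e1 + hX) / 2
  have k2 : c 2 = - c 5 * (q x (s 2) - q x m) / 2 := by linear_combination (e2 + hX) / 2
  have k3 : c 3 = - c 5 * (q x (s 3) - q x m) / 2 := by linear_combination (e3 + hX) / 2
  linear_combination ey - (q y (s 0) - q y m) * k0 - (q y (s 1) - q y m) * k1
    - (q y (s 2) - q y m) * k2 - (q y (s 3) - q y m) * k3 - q y m * hX

theorem eq_zero_of_q_eq_zero {x : Fin 5 → ℝ} (h : ∀ y, q x y = 0) : x = 0 := by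
  have h0 := h ![1, 0, 0, 0, 0]
  have h1 := h ![0, 1, 0, 0, 0]
  have h2 := h ![0, 0, 1, 0, 0]
  have h3 := h ![0, 0, 0, 1, 0]
  have h4 := h ![0, 0, 0, 0, 1]
  simp [q] at h0 h1 h2 h3 h4
  ext i
  fin_cases i <;> simp [h0, h1, h2, h3, h4]

theorem IsFrame.curvature_relation {s : Fin 4 → Fin 5 → ℝ} {m : Fin 5 → ℝ} (h : IsFrame s m) :
    2 * m 0 ^ 2 - 2 * m 0 * (s 0 0 + s 1 0 + s 2 0 + s 3 0)
      + (s 0 0 ^ 2 + s 1 0 ^ 2 + s 2 0 ^ 2 + s 3 0 ^ 2) = 0 := by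
  -- A null vector whose product with `x` reads off the curvature coordinate.
  have hN : ∀ x, q ![0, 0, 0, 0, -2] x = x 0 := by intro x; simp [q]; ring
  have := q_eq_of_gram h.gram h.mid h.mid_self ![0, 0, 0, 0, -2] ![0, 0, 0, 0, -2]
  simp only [hN, Fin.sum_univ_four, Matrix.cons_val] at this
  linarith

/-- The reflection in the span of the `s i` fixes them and moves `m` to the midpoint belonging to
the other gap. -/
theorem IsFrame.flip {s : Fin 4 → Fin 5 → ℝ} {m : Fin 5 → ℝ} (h : IsFrame s m) :
    IsFrame s (s 0 + s 1 + s 2 + s 3 - m) := by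
  have hm := h.mid
  have hm2 := h.mid_self
  have hg := h.gram
  have h1 : q (s 0 + s 1 + s 2 + s 3 - m) (s 0 + s 1 + s 2 + s 3 - m) = -1 := by
    simp only [q_add_left, q_add_right, q_sub_left, q_sub_right, q_comm (s _) m, hm, hm2, hg]
    simp
  refine ⟨hg, fun i => ?_, h1, ?_⟩
  · simp only [q_add_left, q_sub_left, hm, hg]
    fin_cases i <;> simp
  · apply h.future.of_q_neg (by rw [h1]; norm_num)
    simp only [q_add_right, q_sub_right, hm, hm2]; norm_num

end Lorentz

/-! ### Octuples correspond to frames. -/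

namespace Octuple

open Lorentz GenSphere

/-- Any two of the four products add up to -6 by `inscribed_relation`, so each is -3. The excluded
value 1 would make the difference of the two vectors null, against disjointness. -/
theorem q_pair (O : Octuple) (i : Fin 4) : q (O.S' i).vec (O.S i).vec = -3 := by
  have ht := fun i j h => (tangent_iff.1 (O.tangent i j h)).1
  have ht' := fun i j h => (tangent_iff.1 (O.tangent' i j h)).1
  have hc := fun i j h => (q_comm _ _).trans (tangent_iff.1 (O.tangent_cross i j h)).1
  have hne : ∀ i, q (O.S' i).vec (O.S i).vec ≠ 1 := fun i h => by
    refine not_disjoint_of_null ?_ (O.disjoint_pair i)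
    rw [q_sub_left, q_sub_right, q_sub_right, q_comm (O.S i).vec, h, q_vec, q_vec]; norm_num
  have hsum : ∀ i j k l : Fin 4, i ≠ j → i ≠ k → i ≠ l → j ≠ k → j ≠ l → k ≠ l →
      q (O.S' i).vec (O.S i).vec + q (O.S' j).vec (O.S j).vec = -6 := by
    intro i j k l hij hik hil hjk hjl hkl
    exact inscribed_relation (q_vec _) (q_vec _) (q_vec _) (q_vec _) (ht _ _ hij) (ht _ _ hik)
      (ht _ _ hil) (ht _ _ hjk) (ht _ _ hjl) (ht _ _ hkl) (hc _ _ hij.symm) (hc _ _ hik.symm)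
      (hc _ _ hil.symm) (hc _ _ hij) (hc _ _ hjk.symm) (hc _ _ hjl.symm) (q_vec _) (q_vec _)
      (ht' _ _ hij) (hne _) (hne _)
  have hex : ∀ i : Fin 4, ∃ j k l, i ≠ j ∧ i ≠ k ∧ i ≠ l ∧ j ≠ k ∧ j ≠ l ∧ k ≠ l := by decide
  obtain ⟨j, k, l, hij, hik, hil, hjk, hjl, hkl⟩ := hex i
  linarith [hsum i j k l hij hik hil hjk hjl hkl, hsum i k j l hik hij hil hjk.symm hkl hjl,
    hsum j k i l hjk hij.symm hjl hik.symm hkl hil]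

theorem exists_frame (O : Octuple) : ∃ m, IsFrame (fun i => (O.S i).vec) m ∧
    ∀ i, (O.S' i).vec = (2 : ℝ) • m - (O.S i).vec := by
  have ht : ∀ i j, q (O.S i).vec (O.S j).vec = if i = j then 1 else -1 := by
    intro i j
    split_ifs with h
    · rw [h, q_vec]
    · exact (tangent_iff.1 (O.tangent i j h)).1
  have ht' : ∀ i j, q (O.S' i).vec (O.S' j).vec = if i = j then 1 else -1 := by
    intro i j
    split_ifs with h
    · rw [h, q_vec]
    · exact (tangent_iff.1 (O.tangent' i j h)).1
  have hc : ∀ i j, q (O.S' i).vec (O.S j).vec = if i = j then -3 else -1 := by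
    intro i j
    split_ifs with h
    · rw [h, q_pair]
    · exact (q_comm _ _).trans (tangent_iff.1 (O.tangent_cross j i (Ne.symm h))).1
  obtain ⟨m, hm⟩ : ∃ m : Fin 4 → Fin 5 → ℝ,
      m = fun i => (1 / 2 : ℝ) • ((O.S i).vec + (O.S' i).vec) := ⟨_, rfl⟩
  have hms : ∀ i j, q (m i) (O.S j).vec = -1 := by
    intro i j
    rw [hm, q_smul_left, q_add_left, ht, hc]
    split_ifs <;> norm_num
  have hmm : ∀ i j, q (m i) (m j) = -1 := by
    intro i j
    have : q (m i) (O.S' j).vec = -1 := by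
      rw [hm, q_smul_left, q_add_left, ht', q_comm, hc]
      by_cases h : i = j
      · simp [h]; norm_num
      · simp [h, Ne.symm h]; norm_num
    nth_rw 2 [hm]
    rw [q_smul_right, q_add_right, this, hms]; norm_num
  -- All midpoints have the same products with the `S j` and with `m 0`, so their differences are
  -- orthogonal to everything.
  have hme : ∀ i, m i = m 0 := by
    intro i
    rw [← sub_eq_zero]
    apply eq_zero_of_q_eq_zero
    intro y
    rw [q_eq_of_gram ht (hms 0) (hmm 0 0)]
    simp [q_sub_left, hms, hmm]
  refine ⟨m 0, ⟨ht, hms 0, hmm 0 0, ?_⟩, fun i => ?_⟩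
  · apply (tangent_iff.1 (O.tangent 0 1 (by decide))).2.of_q_neg (by rw [hmm]; norm_num)
    rw [q_comm, q_add_right, hms, hms]; norm_num
  · rw [← hme i, hm]; simp

theorem exists_of_frame {S : Fin 4 → GenSphere} {m : Fin 5 → ℝ}
    (h : IsFrame (fun i => (S i).vec) m) :
    ∃ O : Octuple, O.S = S ∧ ∀ i, (O.S' i).vec = (2 : ℝ) • m - (S i).vec := by
  have hm := h.mid
  have hm2 := h.mid_self
  have hg := h.gram
  have hsm := fun i => (q_comm _ _).trans (hm i)
  have hex : ∀ i, ∃ T : GenSphere, T.vec = (2 : ℝ) • m - (S i).vec := by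
    intro i
    apply exists_vec_eq
    simp only [q_sub_left, q_sub_right, q_smul_left, q_smul_right, hm, hm2, hg, hsm]
    simp; norm_num
  choose S' hS' using hex
  -- Two vectors with product -1 with `m` have a sum with product -2, so the future condition is
  -- automatic.
  have key : ∀ T U : GenSphere, q m T.vec = -1 → q m U.vec = -1 → q T.vec U.vec = -1 →
      T.Tangent U := by
    intro T U hT hU hTU
    refine tangent_iff.2 ⟨hTU, h.future.of_q_neg ?_ ?_⟩
    · rw [q_add_left, q_add_right, q_add_right, q_comm U.vec, hTU, q_vec, q_vec]; norm_num
    · rw [q_add_right, hT, hU]; norm_num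
  have hm' : ∀ i, q m (S' i).vec = -1 := by
    intro i; rw [hS', q_sub_right, q_smul_right, hm, hm2]; norm_num
  refine ⟨⟨S, S', fun i j hij => key _ _ (hm _) (hm _) ?_,
    fun i j hij => key _ _ (hm' _) (hm' _) ?_, fun i j hij => key _ _ (hm _) (hm' _) ?_,
    fun i => disjoint_of_future ?_, fun i hi => ?_⟩, rfl, hS'⟩
  · simp [hg, hij]
  · simp only [hS', q_sub_left, q_sub_right, q_smul_left, q_smul_right, hm, hm2, hg, hsm, hij]
    norm_num
  · simp only [hS', q_sub_right, q_smul_right, hg, hsm, hij]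
    norm_num
  · rw [hS', add_sub_cancel]
    have := h.future
    refine ⟨by rw [q_smul_left, q_smul_right, hm2]; norm_num, ?_⟩
    simp only [Pi.smul_apply, smul_eq_mul]
    linarith [this.2]
  · have := (tangent_iff.1 hi).1
    simp only [hS', q_sub_right, q_smul_right, hg, hsm] at this
    norm_num at this

end Octuple

/-! ### Moves on octuples and their effect on vectors. -/

namespace Octuple

open Lorentz GenSphere

theorem hasVector_omega {O : Octuple} {v : Fin 4 → ℤ} {ω : ℤ} (h : O.HasVector v ω) (i : Fin 4) :
    (O.S' i).curvature = 2 * ω - v i := by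
  have := h i
  linarith [this.1, this.2]

theorem curvature_S_mem {O₀ O : Octuple} (h : InPacking O₀ O) (i : Fin 4) :
    (O.S i).curvature ∈ O₀.packingCurvatures :=
  ⟨_, ⟨O, h, Or.inl ⟨i, rfl⟩⟩, rfl⟩

/-- Renumbering the spheres of an octuple. -/
def relabel (O : Octuple) (σ : Equiv.Perm (Fin 4)) : Octuple where
  S i := O.S (σ i)
  S' i := O.S' (σ i)
  tangent _ _ h := O.tangent _ _ (σ.injective.ne h)
  tangent' _ _ h := O.tangent' _ _ (σ.injective.ne h)
  tangent_cross _ _ h := O.tangent_cross _ _ (σ.injective.ne h)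
  disjoint_pair _ := O.disjoint_pair _
  not_tangent_pair _ := O.not_tangent_pair _

theorem inPacking_relabel {O₀ O : Octuple} (h : InPacking O₀ O) (σ : Equiv.Perm (Fin 4)) :
    InPacking O₀ (O.relabel σ) :=
  .step O _ h fun i => Or.inl ⟨σ i, rfl⟩

theorem hasVector_relabel {O : Octuple} {v : Fin 4 → ℤ} {ω : ℤ} (h : O.HasVector v ω)
    (σ : Equiv.Perm (Fin 4)) : (O.relabel σ).HasVector (v ∘ σ) ω :=
  fun i => h (σ i)

/-- Exchanging the two spheres of one pair of an octuple. -/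
def swapPair (O : Octuple) (k : Fin 4) : Octuple where
  S i := if i = k then O.S' i else O.S i
  S' i := if i = k then O.S i else O.S' i
  tangent i j h := by
    split_ifs with h1 h2 h2
    · exact absurd (h1.trans h2.symm) h
    · exact tangent_symm (O.tangent_cross _ _ h.symm)
    · exact O.tangent_cross _ _ h
    · exact O.tangent _ _ h
  tangent' i j h := by
    split_ifs with h1 h2 h2
    · exact absurd (h1.trans h2.symm) h
    · exact O.tangent_cross _ _ h
    · exact tangent_symm (O.tangent_cross _ _ h.symm)
    · exact O.tangent' _ _ h
  tangent_cross i j h := by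
    split_ifs with h1 h2 h2
    · exact absurd (h1.trans h2.symm) h
    · exact O.tangent' _ _ h
    · exact O.tangent _ _ h
    · exact O.tangent_cross _ _ h
  disjoint_pair i := by
    split_ifs
    · exact (O.disjoint_pair i).symm
    · exact O.disjoint_pair i
  not_tangent_pair i := by
    split_ifs
    · exact fun h => O.not_tangent_pair i (tangent_symm h)
    · exact O.not_tangent_pair i

theorem inPacking_swapPair {O₀ O : Octuple} (h : InPacking O₀ O) (k : Fin 4) :
    InPacking O₀ (O.swapPair k) :=
  .step O _ h fun i => by
    simp only [swapPair]
    split_ifs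
    · exact Or.inr ⟨i, rfl⟩
    · exact Or.inl ⟨i, rfl⟩

theorem hasVector_swapPair {O : Octuple} {v : Fin 4 → ℤ} {ω : ℤ} (h : O.HasVector v ω)
    (k : Fin 4) : (O.swapPair k).HasVector (Function.update v k (2 * ω - v k)) ω := by
  intro i
  have h1 := (h i).1
  have h2 := hasVector_omega h i
  by_cases hi : i = k
  · subst hi
    simp [swapPair, h1, h2]
  · simp [swapPair, hi, h1, h2]

theorem frame_zero {O : Octuple} {v : Fin 4 → ℤ} {ω : ℤ} (h : O.HasVector v ω)
    {m : Fin 5 → ℝ} (hm : ∀ i, (O.S' i).vec = (2 : ℝ) • m - (O.S i).vec) : m 0 = ω := by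
  have h1 := congrFun (hm 0) 0
  simp only [Pi.sub_apply, Pi.smul_apply, smul_eq_mul, vec_zero] at h1
  rw [hasVector_omega h, (h 0).1] at h1
  linarith

theorem vector_relation {O : Octuple} {v : Fin 4 → ℤ} {ω : ℤ} (h : O.HasVector v ω) :
    2 * ω ^ 2 - 2 * ω * (v 0 + v 1 + v 2 + v 3)
      + (v 0 ^ 2 + v 1 ^ 2 + v 2 ^ 2 + v 3 ^ 2) = 0 := by
  obtain ⟨m, hF, hm⟩ := O.exists_frame
  have := hF.curvature_relation
  simp only [frame_zero h hm, vec_zero, (h _).1] at this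
  exact_mod_cast this

theorem vector_add_nonneg {O : Octuple} {v : Fin 4 → ℤ} {ω : ℤ} (h : O.HasVector v ω)
    {i j : Fin 4} (hij : i ≠ j) : 0 ≤ v i + v j := by
  have := (tangent_iff.1 (O.tangent i j hij)).2.nonneg.1
  simp only [Pi.add_apply, vec_zero, (h _).1] at this
  exact_mod_cast this

theorem exists_flip {O₀ O : Octuple} (hO : InPacking O₀ O) {v : Fin 4 → ℤ} {ω : ℤ}
    (h : O.HasVector v ω) :
    ∃ O', InPacking O₀ O' ∧ O'.HasVector v (v 0 + v 1 + v 2 + v 3 - ω) := by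
  obtain ⟨m, hF, hm⟩ := O.exists_frame
  obtain ⟨O', hS, hS'⟩ := exists_of_frame hF.flip
  refine ⟨O', .step O O' hO fun i => Or.inl ⟨i, by rw [hS]⟩, fun i => ?_⟩
  have h1 := congrFun (hS' i) 0
  simp only [Pi.sub_apply, Pi.add_apply, Pi.smul_apply, smul_eq_mul, vec_zero, (h _).1,
    frame_zero h hm] at h1
  refine ⟨by rw [hS, (h i).1], ?_⟩
  rw [h1, hS, (h i).1]; push_cast; ring

/-! ### The Hermitian form and the Euclidean algorithm. -/

/-- The Hermitian form in two Gaussian integers attached to the vector of an octuple; after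
subtracting `v 0` it gives curvatures of spheres tangent to the first sphere. -/
def hermForm (v : Fin 4 → ℤ) (ω : ℤ) (α γ : GaussianInt) : ℤ :=
  (v 0 + v 1) * (α.re ^ 2 + α.im ^ 2) + (v 0 + v 2) * (γ.re ^ 2 + γ.im ^ 2)
    + (v 3 - v 0 - v 1 - v 2) * (α.re * γ.re + α.im * γ.im)
    + (2 * ω - (v 0 + v 1 + v 2 + v 3)) * (α.re * γ.im - α.im * γ.re)

/-- The Hermitian form of every octuple of the packing represents at `(α, γ)` a curvature. -/
def Represents (O₀ : Octuple) (α γ : GaussianInt) : Prop :=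
  ∀ O v ω, InPacking O₀ O → O.HasVector v ω →
    ((hermForm v ω α γ - v 0 : ℤ) : ℝ) ∈ O₀.packingCurvatures

variable {O₀ : Octuple} {α γ : GaussianInt}

theorem represents_one_zero : Represents O₀ 1 0 := by
  intro O v ω hO hv
  have : hermForm v ω 1 0 - v 0 = v 1 := by simp [hermForm]
  rw [this, ← (hv 1).1]
  exact curvature_S_mem hO 1

/-- Passing to the other gap only changes the sign of the last coefficient of `hermForm`, as
conjugation does. -/
theorem Represents.conj (h : Represents O₀ α γ) : Represents O₀ (star α) (star γ) := by
  intro O v ω hO hv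
  obtain ⟨O', hO', hv'⟩ := exists_flip hO hv
  convert h O' _ _ hO' hv' using 2
  simp [hermForm]; ring

theorem Represents.swap (h : Represents O₀ α γ) : Represents O₀ γ α := by
  intro O v ω hO hv
  convert h.conj _ _ _ (inPacking_relabel hO (Equiv.swap 1 2))
    (hasVector_relabel hv (Equiv.swap 1 2)) using 2
  have e0 : Equiv.swap (1 : Fin 4) 2 0 = 0 := by decide
  have e3 : Equiv.swap (1 : Fin 4) 2 3 = 3 := by decide
  simp [hermForm, e0, e3]; ring

/-- Replacing `v 3` by `2 * ω - v 3` interchanges the two mixed coefficients. -/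
theorem Represents.mul_neg_I (h : Represents O₀ α γ) : Represents O₀ (⟨0, -1⟩ * α) γ := by
  intro O v ω hO hv
  convert h.conj _ _ _ (inPacking_swapPair hO 3) (hasVector_swapPair hv 3) using 2
  simp [hermForm]; ring

/-- Exchanging `v 2` and `v 3` works because the value at `(1, 1)` is `v 0 + v 3`. -/
theorem Represents.sub_left (h : Represents O₀ α γ) : Represents O₀ (γ - α) γ := by
  intro O v ω hO hv
  convert h.conj _ _ _ (inPacking_relabel hO (Equiv.swap 2 3))
    (hasVector_relabel hv (Equiv.swap 2 3)) using 2
  have e0 : Equiv.swap (2 : Fin 4) 3 0 = 0 := by decide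
  have e1 : Equiv.swap (2 : Fin 4) 3 1 = 1 := by decide
  simp [hermForm, e0, e1]; ring

theorem Represents.neg_left (h : Represents O₀ α γ) : Represents O₀ (-α) γ := by
  convert h.mul_neg_I.mul_neg_I using 1
  ext <;> simp

theorem Represents.add_left (h : Represents O₀ α γ) : Represents O₀ (α + γ) γ := by
  convert h.neg_left.sub_left using 1; ring

theorem Represents.sub_left' (h : Represents O₀ α γ) : Represents O₀ (α - γ) γ := by
  convert h.sub_left.neg_left using 1; ring

theorem Represents.add_int_mul (h : Represents O₀ α γ) (n : ℤ) :
    Represents O₀ (α + n * γ) γ := by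
  induction n with
  | zero => simpa using h
  | succ n ih => convert ih.add_left using 1; push_cast; ring
  | pred n ih => convert ih.sub_left' using 1; push_cast; ring

theorem Represents.add_mul (h : Represents O₀ α γ) (δ : GaussianInt) :
    Represents O₀ (α + δ * γ) γ := by
  -- The imaginary part of `δ` is added as an integer multiple of `-iγ`; three further factors `-i`
  -- turn `-iγ` back into `γ`.
  have h1 : Represents O₀ α (⟨0, -1⟩ * γ) := h.swap.mul_neg_I.swap
  have h2 := (((h1.add_int_mul (-δ.im)).swap.mul_neg_I.mul_neg_I.mul_neg_I).swap).add_int_mul δ.re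
  convert h2 using 1
  · ext <;> simp <;> ring
  · ext <;> simp

theorem represents_of_isCoprime (h : IsCoprime α γ) : Represents O₀ α γ := by
  induction hn : (Zsqrtd.norm γ).natAbs using Nat.strong_induction_on generalizing α γ with
  | _ n ih =>
    by_cases hγ : γ = 0
    · subst hγ
      rw [isCoprime_zero_right] at h
      have hnorm : α.re ^ 2 + α.im ^ 2 = 1 := by
        have := (Zsqrtd.norm_eq_one_iff' (by norm_num) α).2 h
        rw [Zsqrtd.norm_def] at this
        linarith
      intro O v ω hO hv
      convert represents_one_zero O v ω hO hv using 3
      simp [hermForm, hnorm]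
    · have hlt : (Zsqrtd.norm (α % γ)).natAbs < n := by
        rw [← hn]; exact GaussianInt.natAbs_norm_mod_lt α hγ
      have hc : IsCoprime γ (α % γ) := by
        have h2 := EuclideanDomain.mod_add_div α γ
        rw [← h2] at h
        exact (IsCoprime.of_add_mul_left_left h).symm
      convert (ih _ hlt hc rfl).swap.add_mul (α / γ) using 1
      rw [mul_comm]; exact (EuclideanDomain.mod_add_div α γ).symm

end Octuple

/-! ### Positive definiteness. -/

namespace ApollonianForm

theorem coeff_relation {a b c d ω : ℝ} (h : 2 * ω ^ 2 - 2 * ω * (a + b + c + d)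
      + (a ^ 2 + b ^ 2 + c ^ 2 + d ^ 2) = 0) :
    coeffA a b c d ω * coeffD a b c d ω - coeffB a b c d ω ^ 2 - coeffC a b c d ω ^ 2 = a ^ 2 := by
  simp only [coeffA, coeffB, coeffC, coeffD]
  linear_combination (-1 / 2) * h

theorem form_posDef {a b c d ω : ℝ} (h : 2 * ω ^ 2 - 2 * ω * (a + b + c + d)
      + (a ^ 2 + b ^ 2 + c ^ 2 + d ^ 2) = 0) (ha : a ≠ 0) (hA : 0 ≤ a + b) :
    (form a b c d ω).PosDef := by
  have hrel := coeff_relation h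
  have hA : 0 < coeffA a b c d ω := by
    refine lt_of_le_of_ne hA fun h0 => ?_
    change 0 = coeffA a b c d ω at h0
    rw [← h0] at hrel
    have : 0 < a ^ 2 := by positivity
    nlinarith [sq_nonneg (coeffB a b c d ω), sq_nonneg (coeffC a b c d ω)]
  intro x hx
  have hx' : x = ![x 0, x 1, x 2, x 3] := by ext i; fin_cases i <;> rfl
  -- Completing the square; the remaining coefficient `4 * (A D - B² - C²)` is `4 * a ^ 2`.
  have e : coeffA a b c d ω * form a b c d ω x =
      (coeffA a b c d ω * x 0 + 2 * (coeffC a b c d ω * x 2 + coeffB a b c d ω * x 3)) ^ 2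
      + (coeffA a b c d ω * x 1 + 2 * (coeffC a b c d ω * x 3 - coeffB a b c d ω * x 2)) ^ 2
      + 4 * a ^ 2 * (x 2 ^ 2 + x 3 ^ 2) := by
    nth_rw 1 [hx']
    rw [form_apply]
    linear_combination 4 * (x 2 ^ 2 + x 3 ^ 2) * hrel
  have ha2 : 0 < a ^ 2 := by positivity
  refine pos_of_mul_pos_right (lt_of_le_of_ne (by rw [e]; positivity) fun h0 => hx ?_) hA.le
  rw [e] at h0
  generalize coeffA a b c d ω = A at *
  generalize coeffB a b c d ω = B at *
  generalize coeffC a b c d ω = C at *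
  have h23 : x 2 ^ 2 + x 3 ^ 2 = 0 := by
    have : 0 ≤ x 2 ^ 2 + x 3 ^ 2 := by positivity
    nlinarith [sq_nonneg (A * x 0 + 2 * (C * x 2 + B * x 3)),
      sq_nonneg (A * x 1 + 2 * (C * x 3 - B * x 2))]
  have h2 : x 2 = 0 := by nlinarith [sq_nonneg (x 2), sq_nonneg (x 3)]
  have h3 : x 3 = 0 := by nlinarith [sq_nonneg (x 2), sq_nonneg (x 3)]
  simp only [h2, h3] at h0
  have h0' : A * x 0 = 0 := by nlinarith [sq_nonneg (A * x 0), sq_nonneg (A * x 1)]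
  have h1' : A * x 1 = 0 := by nlinarith [sq_nonneg (A * x 0), sq_nonneg (A * x 1)]
  rw [hx', h2, h3, (mul_eq_zero.1 h0').resolve_left hA.ne', (mul_eq_zero.1 h1').resolve_left hA.ne']
  ext i; fin_cases i <;> rfl

end ApollonianForm

/-! ### Parity and the conclusion. -/

theorem GaussianInt.isCoprime_two_mul_right {α β : GaussianInt} (h : IsCoprime α β)
    (hodd : Odd (α.re ^ 2 + α.im ^ 2)) : IsCoprime α (2 * β) := by
  refine IsCoprime.mul_right ?_ h
  obtain ⟨k, hk⟩ := hodd
  -- Bézout from `star α * α = 2 * k + 1`.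
  refine ⟨star α, -k, ?_⟩
  ext
  · simp; linarith
  · simp; ring

namespace Octuple

theorem exists_hasVector_of_isModifiedRootVector {O₀ : Octuple} {a b c d ω : ℤ}
    (h : O₀.IsModifiedRootVector a b c d ω) :
    ∃ O, InPacking O₀ O ∧ O.HasVector ![a, b, c, d] ω ∧ a ≠ 0 ∧ Even a ∧ Odd b := by
  obtain ⟨v, σ, ⟨⟨O, hO, hv⟩, -⟩, ha, hb, rfl, rfl, rfl, rfl⟩ := h
  have hv' := hasVector_relabel hv σ
  by_cases h0 : v (σ 0) = 0
  · refine ⟨_, inPacking_swapPair (inPacking_relabel hO σ) 0, ?_, ?_, ?_, hb⟩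
    · convert hasVector_swapPair hv' 0 using 1
      ext i; fin_cases i <;> simp [h0]
    · simp only [h0, if_true, sub_zero]
      intro hω
      -- With `ω` and the first entry zero, the curvature relation makes a sum of squares vanish,
      -- although one of them is odd.
      have hω : ω = 0 := by omega
      have := vector_relation hv'
      simp only [Function.comp_apply, hω, h0] at this
      have : v (σ 1) = 0 := by
        nlinarith [sq_nonneg (v (σ 1)), sq_nonneg (v (σ 2)), sq_nonneg (v (σ 3))]
      rw [this] at hb
      exact absurd hb (by decide)
    · simp [h0]
  · refine ⟨_, inPacking_relabel hO σ, ?_, ?_, ?_, hb⟩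
    · convert hv' using 1
      ext i; fin_cases i <;> simp [h0]
    · simp [h0]
    · simpa [h0] using ha

end Octuple

theorem mainTheorem2 (O₀ : Octuple) (hP : O₀.IsPrimitiveIntegral) (a₀ b₀ c₀ d₀ ω₀ : ℤ)
    (hv : O₀.IsModifiedRootVector a₀ b₀ c₀ d₀ ω₀) :
    (∃ A B C D : ℤ,
      (A : ℝ) = ApollonianForm.coeffA a₀ b₀ c₀ d₀ ω₀ ∧
      (B : ℝ) = ApollonianForm.coeffB a₀ b₀ c₀ d₀ ω₀ ∧
      (C : ℝ) = ApollonianForm.coeffC a₀ b₀ c₀ d₀ ω₀ ∧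
      (D : ℝ) = ApollonianForm.coeffD a₀ b₀ c₀ d₀ ω₀) ∧
    (ApollonianForm.form a₀ b₀ c₀ d₀ ω₀).PosDef ∧
    ∀ α₁ α₂ β₁ β₂ m : ℤ,
      IsCoprime (⟨α₁, α₂⟩ : GaussianInt) (⟨β₁, β₂⟩ : GaussianInt) →
      (m : ℝ) = ApollonianForm.form a₀ b₀ c₀ d₀ ω₀ ![(α₁ : ℝ), α₂, β₁, β₂] - a₀ →
      Odd m →
      (m : ℝ) ∈ O₀.packingCurvatures := by
  obtain ⟨O, hO, hO', ha0, ha, hb⟩ := Octuple.exists_hasVector_of_isModifiedRootVector hv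
  have hrel := Octuple.vector_relation hO'
  have hA := Octuple.vector_add_nonneg hO' (show (0 : Fin 4) ≠ 1 by decide)
  simp only [Matrix.cons_val] at hrel hA
  -- Modulo 2 the curvature relation says that the sum of the squares, hence the sum, is even.
  obtain ⟨s, hs⟩ : Even (a₀ + b₀ + c₀ + d₀) := by
    have : Even (a₀ ^ 2 + b₀ ^ 2 + c₀ ^ 2 + d₀ ^ 2) :=
      ⟨ω₀ * (a₀ + b₀ + c₀ + d₀) - ω₀ ^ 2, by linarith⟩
    simpa [Int.even_add, Int.even_pow] using this
  have hsR : (a₀ : ℝ) + b₀ + c₀ + d₀ = s + s := by exact_mod_cast hs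
  refine ⟨⟨a₀ + b₀, ω₀ - s, d₀ - s, a₀ + c₀, ?_, ?_, ?_, ?_⟩, ?_, ?_⟩
  · simp [ApollonianForm.coeffA]
  · simp only [ApollonianForm.coeffB]; push_cast; linear_combination hsR / 2
  · simp only [ApollonianForm.coeffC]; push_cast; linear_combination hsR / 2
  · simp [ApollonianForm.coeffD]
  · exact ApollonianForm.form_posDef (by exact_mod_cast hrel) (by exact_mod_cast ha0)
      (by exact_mod_cast hA)
  · intro α₁ α₂ β₁ β₂ m hcop hm hodd
    have hmF : m = Octuple.hermForm ![a₀, b₀, c₀, d₀] ω₀ ⟨α₁, α₂⟩ (2 * ⟨β₁, β₂⟩) - a₀ := by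
      rw [ApollonianForm.form_apply] at hm
      simp only [ApollonianForm.coeffA, ApollonianForm.coeffB, ApollonianForm.coeffC,
        ApollonianForm.coeffD] at hm
      rw [← Int.cast_inj (α := ℝ), hm]
      simp [Octuple.hermForm]; ring
    rw [hmF]
    refine Octuple.represents_of_isCoprime (GaussianInt.isCoprime_two_mul_right hcop ?_) O _ _
      hO hO'
    simp [Octuple.hermForm] at hmF
    -- All terms containing `β` are even because of the factor 2 in `2β`, and `a₀` is even.
    have hprod : Odd ((a₀ + b₀) * (α₁ ^ 2 + α₂ ^ 2)) := by
      have : (a₀ + b₀) * (α₁ ^ 2 + α₂ ^ 2) = m + a₀ - 2 * (2 * (a₀ + c₀) * (β₁ ^ 2 + β₂ ^ 2)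
          + (d₀ - a₀ - b₀ - c₀) * (α₁ * β₁ + α₂ * β₂)
          + (2 * ω₀ - (a₀ + b₀ + c₀ + d₀)) * (α₁ * β₂ - α₂ * β₁)) := by
        rw [hmF]; ring
      rw [this]
      exact (hodd.add_even ha).sub_even (even_two_mul _)
    exact (Int.odd_mul.1 hprod).2
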